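/- Let $d \geq 1$ and let $A \subseteq \mathbb{R}^d$ be a finite set of $n$ points that is generic, that is, no $d+1$ points of $A$ lie on a common hyperplane and no $d+2$ points of $A$ lie on a common $(d-1)$-sphere. Let $k \geq 0$ be an integer. A $k$-facet of $A$ is a set $D \subseteq A$ of $d$ affinely independent points such that the hyperplane through $D$ partitions $A \setminus D$ into $k$ and $n-d-k$ points on its two sides. A directed line $L$ enters the $k$-facet $D$ if $L$ meets the $(d-1)$-simplex $\operatorname{conv} D$ at a point of its relative interior and, passing through this simplex, moves from the side of the hyperplane with $k$ points of $A$ to the side with $n-d-k$ points of $A$. Then every directed line $L$ in $\mathbb{R}^d$ enters at most $\binom{d+k-1}{d-1}$ $k$-facets of $A$. -/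

import Mathlib

/-- A finite set `A` in `ℝ^d` is generic if no `d + 1` of its points lie on a common hyperplane
and no `d + 2` of its points lie on a common `(d - 1)`-sphere. The hyperplanes are the sets
`{x | ⟪u, x⟫ = c}` with `u ≠ 0`. -/
def GenericSet {d : ℕ} (A : Finset (EuclideanSpace ℝ (Fin d))) : Prop :=
  (∀ S ⊆ A, S.card = d + 1 →
    ¬ ∃ (u : EuclideanSpace ℝ (Fin d)) (c : ℝ), u ≠ 0 ∧ ∀ x ∈ S, inner ℝ u x = c) ∧
  (∀ S ⊆ A, S.card = d + 2 →
    ¬ ∃ (z : EuclideanSpace ℝ (Fin d)) (r : ℝ), 0 < r ∧ ∀ x ∈ S, dist x z = r)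

/-- The hyperplane `{x | ⟪u, x⟫ = c}` passes through all points of `D`, and it has exactly `k`
points of `A` strictly on its lower side `⟪u, x⟫ < c` and exactly `n - d - k` points of `A`, where
`n = #A`, strictly on its upper side `⟪u, x⟫ > c`. -/
def SplitsOff {d : ℕ} (A : Finset (EuclideanSpace ℝ (Fin d))) (k : ℕ)
    (D : Finset (EuclideanSpace ℝ (Fin d))) (u : EuclideanSpace ℝ (Fin d)) (c : ℝ) : Prop :=
  u ≠ 0 ∧ (∀ x ∈ D, inner ℝ u x = c) ∧
    (A.filter fun x => inner ℝ u x < c).card = k ∧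
    (A.filter fun x => c < inner ℝ u x).card + d + k = A.card

/-- A `k`-facet of `A`: a subset `D` of `d` points of `A`, spanning a hyperplane (so that its convex
hull is a `(d - 1)`-simplex), such that this hyperplane partitions `A \ D` into `k` and `n - d - k`
points on its two sides. Which side has the `k` points is free, as `(u, c)` may be replaced by
`(-u, -c)`. -/
def IsKFacet {d : ℕ} (A : Finset (EuclideanSpace ℝ (Fin d))) (k : ℕ)
    (D : Finset (EuclideanSpace ℝ (Fin d))) : Prop :=
  D ⊆ A ∧ D.card = d ∧ AffineIndependent ℝ (fun x : D => (x : EuclideanSpace ℝ (Fin d))) ∧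
    ∃ u c, SplitsOff A k D u c

/-- The line `t ↦ p + t • v`, directed by `v`, enters the `k`-facet `D` of `A`: it meets the
`(d - 1)`-simplex `conv D` at a (relative) interior point and there it crosses the hyperplane
through `D` from the side with `k` points of `A` to the side with `n - d - k` points of `A`. -/
def Enters {d : ℕ} (A : Finset (EuclideanSpace ℝ (Fin d))) (k : ℕ)
    (p v : EuclideanSpace ℝ (Fin d)) (D : Finset (EuclideanSpace ℝ (Fin d))) : Prop :=
  (∃ t : ℝ, p + t • v ∈
    intrinsicInterior ℝ (convexHull ℝ (D : Set (EuclideanSpace ℝ (Fin d))))) ∧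
  ∃ u c, SplitsOff A k D u c ∧ 0 < inner ℝ u v

/-! Project along `v`. In the `d`-dimensional space `DirQuotient v` the homogenized line becomes one
vector `b`, and each point `x` of `A` a vector carrying the height `⟪v, x⟫`. If the line enters a
`k`-facet `D`, then `b` is a positive combination of `D`, so `D` is a feasible basis of a linear
program, and exactly `k` points lie below the hyperplane interpolating the heights on `D`. It
suffices to bound the number `h k` of such bases. Moving the line slightly makes `b` generic and
keeps every entered facet feasible.

The bound follows the `h`-vector argument of the upper bound theorem. Each `R` containing a feasible
basis has a unique optimal one, and the `R` with optimum `D` form an interval of sets; summing `(X -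
1) ^ #R` shows that `h` does not depend on the heights (`HasUniqueOptimum.card_filter_eq`). Lifting
one point very high therefore preserves `h`, so deleting a point cannot increase it
(`GenPos.card_filter_erase_le`). Summing over all deletions gives `(j + 1) * h (j + 1) ≤ (d + j) * h
j`, and `h 0 ≤ 1` starts the induction. -/

/-! ### Counting optima, and the recursion for `h` -/

open Finset in
theorem sum_Icc_pow_card {ι R : Type*} [DecidableEq ι] [CommRing R] (x : R) {D T : Finset ι}
    (h : D ⊆ T) : ∑ U ∈ Finset.Icc D T, (x - 1) ^ U.card = (x - 1) ^ D.card * x ^ (T \ D).card := by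
  rw [Finset.Icc_eq_image_powerset h, Finset.sum_image]
  · have h1 : ∀ U ∈ (T \ D).powerset, (x - 1) ^ (D ∪ U).card
        = (x - 1) ^ D.card * ((x - 1) ^ U.card * 1 ^ ((T \ D).card - U.card)) := by
      intro U hU
      rw [Finset.card_union_of_disjoint, pow_add, one_pow, mul_one]
      exact Finset.disjoint_of_subset_right (Finset.mem_powerset.1 hU) Finset.disjoint_sdiff
    rw [Finset.sum_congr rfl h1, ← Finset.mul_sum, Finset.sum_pow_mul_eq_add_pow,
      sub_add_cancel]
  · intro U hU U' hU' hUU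
    have hd : ∀ V ∈ (T \ D).powerset, (D ∪ V) \ D = V := by
      intro V hV
      rw [Finset.union_sdiff_left]
      exact Finset.sdiff_eq_self_of_disjoint
        (Finset.disjoint_of_subset_left (Finset.mem_powerset.1 hV) Finset.sdiff_disjoint)
    rw [← hd U hU, ← hd U' hU']
    exact congrArg (· \ D) hUU

/-- Every subset `R` of `S` that contains a member of the family `𝒟` contains exactly one member
`D` that is not violated by `R`, where `B D` is the set of elements violating `D`. -/
def HasUniqueOptimum {ι : Type*} [DecidableEq ι] (S : Finset ι) (𝒟 : Finset (Finset ι))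
    (B : Finset ι → Finset ι) : Prop :=
  (∀ D ∈ 𝒟, B D ⊆ S \ D) ∧
    ∀ R ⊆ S, (∃ D ∈ 𝒟, D ⊆ R) → ∃! D, D ∈ 𝒟 ∧ D ⊆ R ∧ Disjoint R (B D)

-- The sets `R` with optimum `D` are those between `D` and `S \ B D`, so they contribute a binomial
-- sum. The left side does not mention `B`.
open Polynomial in
theorem HasUniqueOptimum.sum_pow {ι : Type*} [DecidableEq ι] {S : Finset ι} {d : ℕ}
    {𝒟 : Finset (Finset ι)} (h𝒟 : ∀ D ∈ 𝒟, D ⊆ S ∧ D.card = d) {B : Finset ι → Finset ι}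
    (hB : HasUniqueOptimum S 𝒟 B) :
    ∑ R ∈ S.powerset with ∃ D ∈ 𝒟, D ⊆ R, ((X : ℤ[X]) - 1) ^ R.card
      = (X - 1) ^ d * ∑ D ∈ 𝒟, X ^ (S.card - d - (B D).card) := by
  have h1 : ∀ D ∈ 𝒟, ((X : ℤ[X]) - 1) ^ d * X ^ (S.card - d - (B D).card)
      = ∑ R ∈ S.powerset, if D ⊆ R ∧ Disjoint R (B D) then (X - 1) ^ R.card else 0 := by
    intro D hD
    have hBD := hB.1 D hD
    have hsub : D ⊆ S \ B D := by
      intro i hi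
      refine Finset.mem_sdiff.2 ⟨(h𝒟 D hD).1 hi, fun hi' => ?_⟩
      exact (Finset.mem_sdiff.1 (hBD hi')).2 hi
    have hcard : ((S \ B D) \ D).card = S.card - d - (B D).card := by
      rw [Finset.card_sdiff_of_subset hsub, Finset.card_sdiff_of_subset
        (hBD.trans Finset.sdiff_subset), (h𝒟 D hD).2]
      omega
    rw [← Finset.sum_filter, ← hcard]
    nth_rewrite 1 [← (h𝒟 D hD).2]
    rw [← sum_Icc_pow_card _ hsub]
    refine Finset.sum_congr ?_ fun _ _ => rfl
    ext R
    simp only [Finset.mem_Icc, Finset.mem_filter, Finset.mem_powerset,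
      Finset.subset_sdiff]
    tauto
  rw [Finset.mul_sum, Finset.sum_congr rfl h1, Finset.sum_comm, Finset.sum_filter]
  refine Finset.sum_congr rfl fun R hR => ?_
  rw [← Finset.sum_filter]
  split_ifs with h
  · obtain ⟨D, hD, huniq⟩ := hB.2 R (Finset.mem_powerset.1 hR) h
    have : (𝒟.filter fun D => D ⊆ R ∧ Disjoint R (B D)) = {D} := by
      ext D'
      simp only [Finset.mem_filter, Finset.mem_singleton]
      exact ⟨fun h' => huniq D' h', fun h' => h' ▸ hD⟩
    rw [this, Finset.sum_singleton]
  · rw [Finset.filter_false_of_mem, Finset.sum_empty]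
    exact fun D hD hDR => h ⟨D, hD, hDR.1⟩

open Polynomial in
theorem HasUniqueOptimum.card_filter_eq {ι : Type*} [DecidableEq ι] {S : Finset ι} {d : ℕ}
    {𝒟 : Finset (Finset ι)} (h𝒟 : ∀ D ∈ 𝒟, D ⊆ S ∧ D.card = d) {B B' : Finset ι → Finset ι}
    (hB : HasUniqueOptimum S 𝒟 B) (hB' : HasUniqueOptimum S 𝒟 B') (j : ℕ) :
    (𝒟.filter fun D => (B D).card = j).card = (𝒟.filter fun D => (B' D).card = j).card := by
  have h0 : ((X : ℤ[X]) - 1) ^ d ≠ 0 := pow_ne_zero _ (by simpa using X_sub_C_ne_zero (1 : ℤ))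
  have h := mul_left_cancel₀ h0 ((hB.sum_pow h𝒟).symm.trans (hB'.sum_pow h𝒟))
  -- Without this bound, truncated subtraction could merge different values of `#(C D)` into one
  -- exponent.
  have hle : ∀ {C : Finset ι → Finset ι}, HasUniqueOptimum S 𝒟 C → ∀ D ∈ 𝒟,
      (C D).card ≤ S.card - d := by
    intro C hC D hD
    rw [← (h𝒟 D hD).2, ← Finset.card_sdiff_of_subset (h𝒟 D hD).1]
    exact Finset.card_le_card (hC.1 D hD)
  by_cases hj : j ≤ S.card - d
  · have hco : ∀ {C : Finset ι → Finset ι}, HasUniqueOptimum S 𝒟 C →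
        (∑ D ∈ 𝒟, (X : ℤ[X]) ^ (S.card - d - (C D).card)).coeff (S.card - d - j)
          = ((𝒟.filter fun D => (C D).card = j).card : ℤ) := by
      intro C hC
      rw [finsetSum_coeff, Finset.card_filter, Nat.cast_sum]
      refine Finset.sum_congr rfl fun D hD => ?_
      have := hle hC D hD
      rw [coeff_X_pow]
      by_cases hc : (C D).card = j
      · simp [hc]
      · rw [if_neg (by omega), if_neg hc, Nat.cast_zero]
    have := congrArg (fun q => q.coeff (S.card - d - j)) h
    simp only [hco hB, hco hB'] at this
    exact_mod_cast this
  · rw [Finset.filter_false_of_mem, Finset.filter_false_of_mem]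
    · intro D hD
      have := hle hB' D hD
      omega
    · intro D hD
      have := hle hB D hD
      omega

/-- Double count pairs `(p, D)` with `p ∉ D` and `j` violators left after erasing `p`: a `D` with
`j` violators occurs `#S - d - j` times, one with `j + 1` violators `j + 1` times. -/
theorem succ_mul_card_filter_le {ι : Type*} [DecidableEq ι] {S : Finset ι} {d : ℕ}
    {𝒟 : Finset (Finset ι)} (h𝒟 : ∀ D ∈ 𝒟, D ⊆ S ∧ D.card = d) {B : Finset ι → Finset ι}
    (hB : ∀ D ∈ 𝒟, B D ⊆ S \ D) {j : ℕ}
    (hmono : ∀ p ∈ S, (𝒟.filter fun D => p ∉ D ∧ ((B D).erase p).card = j).card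
      ≤ (𝒟.filter fun D => (B D).card = j).card) :
    (j + 1) * (𝒟.filter fun D => (B D).card = j + 1).card
      ≤ (d + j) * (𝒟.filter fun D => (B D).card = j).card := by
  set H := (𝒟.filter fun D => (B D).card = j).card with hH
  set H' := (𝒟.filter fun D => (B D).card = j + 1).card with hH'
  have h1 : ∑ p ∈ S, (𝒟.filter fun D => p ∉ D ∧ ((B D).erase p).card = j).card ≤ S.card * H := by
    simpa using Finset.sum_le_sum hmono
  have h2 : ∑ p ∈ S, (𝒟.filter fun D => p ∉ D ∧ ((B D).erase p).card = j).card
      = ∑ D ∈ 𝒟, (S.filter fun p => p ∉ D ∧ ((B D).erase p).card = j).card := by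
    simp only [Finset.card_filter]
    exact Finset.sum_comm
  have h3 : ∀ D ∈ 𝒟, ((if (B D).card = j then S.card - d - j else 0)
      + if (B D).card = j + 1 then j + 1 else 0)
      ≤ (S.filter fun p => p ∉ D ∧ ((B D).erase p).card = j).card := by
    intro D hD
    have hBD := hB D hD
    by_cases hj : (B D).card = j
    · rw [if_pos hj, if_neg (by omega), add_zero]
      have : S.card - d - j = ((S \ D) \ B D).card := by
        rw [Finset.card_sdiff_of_subset hBD, Finset.card_sdiff_of_subset (h𝒟 D hD).1, hj,
          (h𝒟 D hD).2]
      rw [this]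
      refine Finset.card_le_card fun p hp => ?_
      simp only [Finset.mem_sdiff] at hp
      rw [Finset.mem_filter, Finset.erase_eq_of_notMem hp.2]
      exact ⟨hp.1.1, hp.1.2, hj⟩
    · rw [if_neg hj, zero_add]
      split_ifs with hj'
      · rw [← hj']
        refine Finset.card_le_card fun p hp => ?_
        have := Finset.mem_sdiff.1 (hBD hp)
        rw [Finset.mem_filter, Finset.card_erase_of_mem hp, hj']
        exact ⟨this.1, this.2, rfl⟩
      · exact Nat.zero_le _
  have h4 := Finset.sum_le_sum h3
  rw [Finset.sum_add_distrib, ← Finset.sum_filter, ← Finset.sum_filter, Finset.sum_const,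
    Finset.sum_const, ← hH, ← hH', smul_eq_mul, smul_eq_mul, ← h2] at h4
  have h5 := h4.trans h1
  rcases Nat.eq_zero_or_pos H with h0 | hpos
  · rw [h0] at h5 ⊢
    nlinarith
  · obtain ⟨D, hD⟩ := Finset.card_pos.1 hpos
    rw [Finset.mem_filter] at hD
    have hle : d + j ≤ S.card := by
      have := Finset.card_le_card (hB D hD.1)
      rw [Finset.card_sdiff_of_subset (h𝒟 D hD.1).1, (h𝒟 D hD.1).2, hD.2] at this
      have := Finset.card_le_card (h𝒟 D hD.1).1
      rw [(h𝒟 D hD.1).2] at this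
      omega
    obtain ⟨m, hm⟩ := Nat.exists_eq_add_of_le hle
    have : S.card - d - j = m := by omega
    rw [this, hm] at h5
    nlinarith

theorem le_choose_of_succ_mul_le {d : ℕ} (hd : 1 ≤ d) {h : ℕ → ℕ} (h0 : h 0 ≤ 1)
    (hs : ∀ j, (j + 1) * h (j + 1) ≤ (d + j) * h j) (k : ℕ) :
    h k ≤ (d + k - 1).choose (d - 1) := by
  obtain ⟨e, rfl⟩ := Nat.exists_eq_add_of_le' hd
  simp only [Nat.add_sub_cancel]
  induction k with
  | zero => simpa using h0
  | succ k ih =>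
    have e1 : e + 1 + k - 1 = e + k := by omega
    have e2 : e + 1 + (k + 1) - 1 = e + k + 1 := by omega
    rw [e1] at ih
    rw [e2]
    have key := Nat.add_one_mul_choose_eq (e + k) k
    rw [← Nat.choose_symm_add, Nat.choose_symm_of_eq_add (show e + k + 1 = k + 1 + e by ring)]
      at key
    refine Nat.le_of_mul_le_mul_left ?_ (Nat.succ_pos k)
    calc (k + 1) * h (k + 1) ≤ (e + 1 + k) * h k := hs k
      _ ≤ (e + 1 + k) * (e + k).choose e := Nat.mul_le_mul_left _ ih
      _ = (k + 1) * (e + k + 1).choose e := by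
        rw [mul_comm (k + 1), ← key]
        ring

/-! ### Linear programs with varying heights -/

section FeasibleBasis

open Module

variable {ι W : Type*} [AddCommGroup W] [Module ℝ W]

/-- `b` is a combination of the vectors `a i`, `i ∈ D`, with positive coefficients. -/
def PosRep (a : ι → W) (b : W) (D : Finset ι) : Prop :=
  ∃ c : ι → ℝ, (∀ i ∈ D, 0 < c i) ∧ ∑ i ∈ D, c i • a i = b

open Classical in
/-- The feasible bases of the linear program `∑ i ∈ S, c i • a i = b`, `c ≥ 0`. -/
noncomputable def feasibleBases (S : Finset ι) (a : ι → W) (b : W) : Finset (Finset ι) :=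
  S.powerset.filter fun D => D.card = finrank ℝ W ∧ PosRep a b D

open Classical in
/-- The linear functional taking the values `z` on the vectors of a basis `D`. -/
noncomputable def interp (a : ι → W) (z : ι → ℝ) (D : Finset ι) : W →ₗ[ℝ] ℝ :=
  if h : ∃ ψ : W →ₗ[ℝ] ℝ, ∀ i ∈ D, ψ (a i) = z i then h.choose else 0

/-- The indices whose height is less than that of the hyperplane interpolating `D`. -/
noncomputable def below (S : Finset ι) (a : ι → W) (z : ι → ℝ) (D : Finset ι) : Finset ι :=
  S.filter fun q => z q < interp a z D (a q)

/-- `b` is in general position with respect to the vectors `a i`, `i ∈ S`. -/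
def GenPos (S : Finset ι) (a : ι → W) (b : W) : Prop :=
  ∀ T ⊆ S, T.card < finrank ℝ W → b ∉ Submodule.span ℝ (a '' T)

variable {S D D' R : Finset ι} {a : ι → W} {b : W} {z : ι → ℝ}

theorem mem_feasibleBases :
    D ∈ feasibleBases S a b ↔ D ⊆ S ∧ D.card = finrank ℝ W ∧ PosRep a b D := by
  simp [feasibleBases]

theorem PosRep.mem_span (h : PosRep a b D) : b ∈ Submodule.span ℝ (a '' D) := by
  obtain ⟨c, -, rfl⟩ := h
  exact Submodule.sum_mem _ fun i hi =>
    Submodule.smul_mem _ _ (Submodule.subset_span ⟨i, hi, rfl⟩)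

theorem exists_basis_of_linearIndepOn [FiniteDimensional ℝ W] (h : LinearIndepOn ℝ a (D : Set ι))
    (hcard : D.card = finrank ℝ W) : ∃ e : Basis D ℝ W, ∀ i, e i = a i := by
  have h' : LinearIndependent ℝ (fun i : D => a i) := h
  exact ⟨Basis.mk h' (h'.span_eq_top_of_card_eq_finrank' (by simpa using hcard)).ge, by simp⟩

variable [DecidableEq ι]

/-- The heights `z` are in general position. -/
def NondegHeights (S : Finset ι) (a : ι → W) (b : W) (z : ι → ℝ) : Prop :=
  ∀ D ∈ feasibleBases S a b, ∀ q ∈ S \ D, z q ≠ interp a z D (a q)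

theorem GenPos.linearIndepOn (h : GenPos S a b) (hD : D ∈ feasibleBases S a b) :
    LinearIndepOn ℝ a (D : Set ι) := by
  obtain ⟨hDS, hcard, hpos⟩ := mem_feasibleBases.1 hD
  rw [linearIndepOn_iff_notMem_span]
  intro i hi hmem
  refine h (D.erase i) ((D.erase_subset i).trans hDS) ?_ ?_
  · rw [← hcard]
    exact Finset.card_erase_lt_of_mem hi
  · refine (Submodule.span_le.2 ?_) hpos.mem_span
    rintro _ ⟨i', hi', rfl⟩
    rw [Finset.coe_erase]
    by_cases h' : i' = i
    · exact h' ▸ hmem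
    · exact Submodule.subset_span ⟨i', ⟨hi', h'⟩, rfl⟩

theorem sum_insert_erase_smul {M : Type*} [AddCommGroup M] [Module ℝ M] {c c' μ : ι → ℝ}
    {r s : ι} {t : ℝ} (hrs : r ∉ D.erase s) (hr : c' r = t)
    (hD : ∀ i ∈ D, c' i = c i - t * μ i) (hs : c s - t * μ s = 0) {f : ι → M} :
    ∑ i ∈ insert r (D.erase s), c' i • f i
      = t • f r + (∑ i ∈ D, c i • f i - t • ∑ i ∈ D, μ i • f i) := by
  have hsum : ∑ i ∈ D.erase s, c' i • f i = ∑ i ∈ D, (c i - t * μ i) • f i := by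
    rw [← Finset.sum_erase D (a := s) (f := fun i => (c i - t * μ i) • f i)
      (by rw [hs, zero_smul])]
    exact Finset.sum_congr rfl fun i hi => by rw [hD i (Finset.mem_of_mem_erase hi)]
  rw [Finset.sum_insert hrs, hr, hsum, Finset.smul_sum, ← Finset.sum_sub_distrib]
  simp only [sub_smul, mul_smul]

variable [FiniteDimensional ℝ W]

theorem GenPos.exists_basis (h : GenPos S a b) (hD : D ∈ feasibleBases S a b) :
    ∃ e : Basis D ℝ W, ∀ i, e i = a i :=
  exists_basis_of_linearIndepOn (h.linearIndepOn hD) (mem_feasibleBases.1 hD).2.1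

theorem GenPos.interp_apply (h : GenPos S a b) (hD : D ∈ feasibleBases S a b) (z : ι → ℝ)
    {i : ι} (hi : i ∈ D) : interp a z D (a i) = z i := by
  obtain ⟨e, he⟩ := h.exists_basis hD
  have hex : ∃ ψ : W →ₗ[ℝ] ℝ, ∀ i ∈ D, ψ (a i) = z i :=
    ⟨e.constr ℝ fun i => z i, fun i hi => by rw [← he ⟨i, hi⟩, Basis.constr_basis]⟩
  rw [interp, dif_pos hex]
  exact hex.choose_spec i hi

theorem GenPos.eq_interp (h : GenPos S a b) (hD : D ∈ feasibleBases S a b)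
    {ψ : W →ₗ[ℝ] ℝ} (hψ : ∀ i ∈ D, ψ (a i) = z i) : interp a z D = ψ := by
  obtain ⟨e, he⟩ := h.exists_basis hD
  refine e.ext fun i => ?_
  rw [he, h.interp_apply hD z i.2, hψ i i.2]

theorem GenPos.below_subset (h : GenPos S a b) (hD : D ∈ feasibleBases S a b) :
    below S a z D ⊆ S \ D := by
  intro q hq
  obtain ⟨hqS, hq⟩ := Finset.mem_filter.1 hq
  refine Finset.mem_sdiff.2 ⟨hqS, fun hqD => ?_⟩
  rw [h.interp_apply hD z hqD] at hq
  exact hq.false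

/-- A simplex pivot: `r` enters, and the ratio test picks the leaving `s`. The normalization `σ`
makes the coefficients `μ` sum to `1`, so some is positive and the step is bounded. -/
theorem GenPos.exists_pivot (h : GenPos S a b) {σ : W →ₗ[ℝ] ℝ} (hσ : ∀ i ∈ S, σ (a i) = 1)
    (hD : D ∈ feasibleBases S a b) {r : ι} (hr : r ∈ below S a z D) :
    ∃ D' ∈ feasibleBases S a b, D' ⊆ insert r D ∧ interp a z D' b < interp a z D b := by
  obtain ⟨hrS, hrD⟩ := Finset.mem_sdiff.1 (h.below_subset hD hr)
  have hz := (Finset.mem_filter.1 hr).2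
  obtain ⟨hDS, hcard, c, hc, hcb⟩ := mem_feasibleBases.1 hD
  obtain ⟨e, he⟩ := h.exists_basis hD
  obtain ⟨μ, hμ⟩ : ∃ μ : ι → ℝ, ∑ i ∈ D, μ i • a i = a r := by
    refine ⟨fun i => if hi : i ∈ D then e.repr (a r) ⟨i, hi⟩ else 0, ?_⟩
    rw [← Finset.sum_coe_sort]
    conv_rhs => rw [← e.sum_repr (a r)]
    exact Finset.sum_congr rfl fun i _ => by simp [he]
  have hμ1 : ∑ i ∈ D, μ i = 1 := by
    rw [← hσ r hrS, ← hμ, map_sum]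
    exact Finset.sum_congr rfl fun i hi => by rw [map_smul, hσ i (hDS hi), smul_eq_mul, mul_one]
  have hne : (D.filter fun i => 0 < μ i).Nonempty := by
    obtain ⟨i, hi, hi'⟩ := Finset.exists_lt_of_sum_lt (s := D) (f := 0) (g := μ) (by simp [hμ1])
    exact ⟨i, Finset.mem_filter.2 ⟨hi, hi'⟩⟩
  obtain ⟨s, hs, hmin⟩ := Finset.exists_min_image _ (fun i => c i / μ i) hne
  obtain ⟨hsD, hsμ⟩ := Finset.mem_filter.1 hs
  set t := c s / μ s with ht
  have htpos : 0 < t := div_pos (hc s hsD) hsμ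
  have hnonneg : ∀ i ∈ D, 0 ≤ c i - t * μ i := by
    intro i hi
    rcases le_or_gt (μ i) 0 with hle | hlt
    · nlinarith [hc i hi]
    · have := hmin i (Finset.mem_filter.2 ⟨hi, hlt⟩)
      rw [le_div_iff₀ hlt] at this
      linarith
  have hszero : c s - t * μ s = 0 := by
    rw [ht, div_mul_cancel₀ _ hsμ.ne', sub_self]
  have hrs : r ∉ D.erase s := fun h' => hrD (Finset.mem_of_mem_erase h')
  set c' : ι → ℝ := fun i => if i = r then t else c i - t * μ i with hc'
  have hc'D : ∀ i ∈ D, c' i = c i - t * μ i := fun i hi =>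
    if_neg fun (h' : i = r) => hrD (h' ▸ hi)
  have hc'r : c' r = t := if_pos rfl
  have hcb' : ∑ i ∈ insert r (D.erase s), c' i • a i = b := by
    rw [sum_insert_erase_smul hrs hc'r hc'D hszero, hcb, hμ]
    abel
  have hcard' : (insert r (D.erase s)).card = finrank ℝ W := by
    rw [Finset.card_insert_of_notMem hrs, Finset.card_erase_add_one hsD, hcard]
  have hsub : insert r (D.erase s) ⊆ S :=
    Finset.insert_subset hrS ((D.erase_subset s).trans hDS)
  have hpos : ∀ i ∈ insert r (D.erase s), 0 < c' i := by
    intro i hi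
    have h0 : 0 ≤ c' i := by
      rcases Finset.mem_insert.1 hi with rfl | hi'
      · simpa [hc'] using htpos.le
      · have := Finset.mem_of_mem_erase hi'
        rw [hc'D i this]
        exact hnonneg i this
    -- A zero coefficient would put `b` in the span of too few vectors.
    refine lt_of_le_of_ne h0 fun h0 => ?_
    refine h ((insert r (D.erase s)).erase i) ((Finset.erase_subset _ _).trans hsub) ?_ ?_
    · rw [← hcard']
      exact Finset.card_erase_lt_of_mem hi
    · rw [← hcb', ← Finset.sum_erase _ (a := i) (by rw [← h0, zero_smul])]
      exact Submodule.sum_mem _ fun i hi =>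
        Submodule.smul_mem _ _ (Submodule.subset_span ⟨i, hi, rfl⟩)
  have hD' : insert r (D.erase s) ∈ feasibleBases S a b :=
    mem_feasibleBases.2 ⟨hsub, hcard', c', hpos, hcb'⟩
  refine ⟨_, hD', Finset.insert_subset_insert _ (D.erase_subset s), ?_⟩
  have e1 : ∑ i ∈ D, c i • z i = interp a z D b := by
    rw [← hcb, map_sum]
    exact Finset.sum_congr rfl fun i hi => by rw [map_smul, h.interp_apply hD z hi]
  have e2 : ∑ i ∈ D, μ i • z i = interp a z D (a r) := by
    rw [← hμ, map_sum]
    exact Finset.sum_congr rfl fun i hi => by rw [map_smul, h.interp_apply hD z hi]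
  have e3 : interp a z (insert r (D.erase s)) b
      = ∑ i ∈ insert r (D.erase s), c' i • z i := by
    conv_lhs => rw [← hcb', map_sum]
    exact Finset.sum_congr rfl fun i hi => by rw [map_smul, h.interp_apply hD' z hi]
  rw [e3, sum_insert_erase_smul hrs hc'r hc'D hszero, e1, e2, smul_eq_mul, smul_eq_mul]
  nlinarith

/-- Weak duality: the hyperplane of `D` is nowhere above the points of `D'`, and `b` is a positive
combination of them. -/
theorem GenPos.interp_le (h : GenPos S a b) (hz : NondegHeights S a b z)
    (hD : D ∈ feasibleBases S a b) (hD' : D' ∈ feasibleBases S a b)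
    (hdisj : Disjoint D' (below S a z D)) :
    interp a z D b ≤ interp a z D' b ∧ (interp a z D b = interp a z D' b → D' = D) := by
  obtain ⟨hD'S, hcard', c, hc, hcb⟩ := mem_feasibleBases.1 hD'
  have e1 : interp a z D b = ∑ i ∈ D', c i * interp a z D (a i) := by
    conv_lhs => rw [← hcb, map_sum]
    simp
  have e2 : interp a z D' b = ∑ i ∈ D', c i * z i := by
    conv_lhs => rw [← hcb, map_sum]
    exact Finset.sum_congr rfl fun i hi => by
      rw [map_smul, h.interp_apply hD' z hi, smul_eq_mul]
  have hle : ∀ i ∈ D', interp a z D (a i) ≤ z i := fun i hi =>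
    not_lt.1 fun hlt => Finset.disjoint_left.1 hdisj hi (Finset.mem_filter.2 ⟨hD'S hi, hlt⟩)
  have hle' : ∀ i ∈ D', c i * interp a z D (a i) ≤ c i * z i := fun i hi =>
    mul_le_mul_of_nonneg_left (hle i hi) (hc i hi).le
  rw [e1, e2]
  refine ⟨Finset.sum_le_sum hle', fun heq => ?_⟩
  rw [Finset.sum_eq_sum_iff_of_le hle'] at heq
  refine Finset.eq_of_subset_of_card_le (fun i hi => ?_) ?_
  · by_contra hiD
    exact hz D hD i (Finset.mem_sdiff.2 ⟨hD'S hi, hiD⟩)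
      (mul_left_cancel₀ (hc i hi).ne' (heq i hi)).symm
  · rw [hcard', (mem_feasibleBases.1 hD).2.1]

theorem GenPos.hasUniqueOptimum (h : GenPos S a b) {σ : W →ₗ[ℝ] ℝ}
    (hσ : ∀ i ∈ S, σ (a i) = 1) (hz : NondegHeights S a b z) :
    HasUniqueOptimum S (feasibleBases S a b) (below S a z) := by
  refine ⟨fun D hD => h.below_subset hD, fun R hRS hR => ?_⟩
  have hne : ((feasibleBases S a b).filter fun D => D ⊆ R).Nonempty := by
    obtain ⟨D, hD, hDR⟩ := hR
    exact ⟨D, Finset.mem_filter.2 ⟨hD, hDR⟩⟩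
  obtain ⟨D, hDmem, hmin⟩ := Finset.exists_min_image _ (fun D => interp a z D b) hne
  obtain ⟨hD, hDR⟩ := Finset.mem_filter.1 hDmem
  have hdisj : Disjoint R (below S a z D) := by
    rw [Finset.disjoint_left]
    intro r hrR hr
    obtain ⟨D', hD', hD'D, hlt⟩ := h.exists_pivot hσ hD hr
    exact (hmin D' (Finset.mem_filter.2
      ⟨hD', hD'D.trans (Finset.insert_subset hrR hDR)⟩)).not_gt hlt
  refine ⟨D, ⟨hD, hDR, hdisj⟩, ?_⟩
  rintro D' ⟨hD', hD'R, hdisj'⟩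
  have h1 := h.interp_le hz hD hD' (Finset.disjoint_of_subset_left hD'R hdisj)
  have h2 := h.interp_le hz hD' hD (Finset.disjoint_of_subset_left hDR hdisj')
  exact h1.2 (le_antisymm h1.1 h2.1)

theorem GenPos.exists_lift (h : GenPos S a b) (hz : NondegHeights S a b z) (p : ι) :
    ∃ t : ℝ, NondegHeights S a b (Function.update z p t) ∧
      ∀ D ∈ feasibleBases S a b, p ∉ D → p ∉ below S a (Function.update z p t) D := by
  have hup : ∀ D ∈ feasibleBases S a b, p ∉ D → ∀ t,
      interp a (Function.update z p t) D = interp a z D := by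
    intro D hD hp t
    refine h.eq_interp hD fun i hi => ?_
    rw [h.interp_apply hD z hi, Function.update_of_ne fun (h' : i = p) => hp (h' ▸ hi)]
  have hinterp : ∀ D ∈ feasibleBases S a b, p ∈ D → ∀ t,
      interp a (Function.update z p t) D
        = interp a z D + (t - z p) • interp a (Pi.single p 1) D := by
    intro D hD hp t
    refine h.eq_interp hD fun i hi => ?_
    rw [LinearMap.add_apply, LinearMap.smul_apply, h.interp_apply hD z hi,
      h.interp_apply hD _ hi]
    by_cases hip : i = p
    · subst hip
      simp
    · simp [hip]
  have h1 : ∀ᶠ t in Filter.atTop, ∀ D ∈ feasibleBases S a b, interp a z D (a p) < t := by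
    rw [Filter.eventually_all_finset]
    exact fun D _ => Filter.eventually_gt_atTop _
  -- For `p ∈ D` the interpolant is affine in `t`, so each `q` rules out at most one `t`. A zero
  -- denominator excludes a harmless junk value.
  have h2 : ∀ᶠ t in Filter.atTop, ∀ D ∈ feasibleBases S a b, ∀ q ∈ S,
      t ≠ z p + (z q - interp a z D (a q)) / interp a (Pi.single p 1) D (a q) := by
    rw [Filter.eventually_all_finset]
    intro D _
    rw [Filter.eventually_all_finset]
    exact fun q _ => Filter.eventually_ne_atTop _
  obtain ⟨t, ht1, ht2⟩ := (h1.and h2).exists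
  refine ⟨t, fun D hD q hq => ?_, fun D hD hp hbelow => ?_⟩
  · obtain ⟨hqS, hqD⟩ := Finset.mem_sdiff.1 hq
    by_cases hp : p ∈ D
    · have hqp : q ≠ p := fun h' => hqD (h' ▸ hp)
      rw [hinterp D hD hp, Function.update_of_ne hqp, LinearMap.add_apply,
        LinearMap.smul_apply, smul_eq_mul]
      intro heq
      by_cases hθ : interp a (Pi.single p 1) D (a q) = 0
      · rw [hθ, mul_zero, add_zero] at heq
        exact hz D hD q hq heq
      · refine ht2 D hD q hqS ?_
        field_simp
        linarith
    · rw [hup D hD hp]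
      by_cases hqp : q = p
      · subst hqp
        rw [Function.update_self]
        exact (ht1 D hD).ne'
      · rw [Function.update_of_ne hqp]
        exact hz D hD q hq
  · have := (Finset.mem_filter.1 hbelow).2
    rw [hup D hD hp, Function.update_self] at this
    exact this.not_ge (ht1 D hD).le

theorem GenPos.card_filter_erase_le (h : GenPos S a b) {σ : W →ₗ[ℝ] ℝ}
    (hσ : ∀ i ∈ S, σ (a i) = 1) (hz : NondegHeights S a b z) (p : ι) (j : ℕ) :
    ((feasibleBases S a b).filter fun D => p ∉ D ∧ ((below S a z D).erase p).card = j).card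
      ≤ ((feasibleBases S a b).filter fun D => (below S a z D).card = j).card := by
  obtain ⟨t, ht, htp⟩ := h.exists_lift hz p
  rw [(h.hasUniqueOptimum hσ hz).card_filter_eq
    (fun D hD => ⟨(mem_feasibleBases.1 hD).1, (mem_feasibleBases.1 hD).2.1⟩)
    (h.hasUniqueOptimum hσ ht) j]
  refine Finset.card_le_card fun D hD => ?_
  obtain ⟨hDb, hp, hj⟩ := Finset.mem_filter.1 hD
  refine Finset.mem_filter.2 ⟨hDb, ?_⟩
  rw [← hj]
  congr 1
  have hup : interp a (Function.update z p t) D = interp a z D := by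
    refine h.eq_interp hDb fun i hi => ?_
    rw [h.interp_apply hDb z hi, Function.update_of_ne fun (h' : i = p) => hp (h' ▸ hi)]
  ext q
  by_cases hqp : q = p
  · subst hqp
    simpa using htp D hDb hp
  · simp [below, hup, hqp]

theorem GenPos.card_filter_below_le (h : GenPos S a b) {σ : W →ₗ[ℝ] ℝ}
    (hσ : ∀ i ∈ S, σ (a i) = 1) (hz : NondegHeights S a b z) (hd : 1 ≤ finrank ℝ W) (k : ℕ) :
    ((feasibleBases S a b).filter fun D => (below S a z D).card = k).card
      ≤ (finrank ℝ W + k - 1).choose (finrank ℝ W - 1) := by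
  have hopt := h.hasUniqueOptimum hσ hz
  refine le_choose_of_succ_mul_le hd
    (h := fun k => ((feasibleBases S a b).filter fun D => (below S a z D).card = k).card)
    ?_ (fun j => ?_) k
  · refine Finset.card_le_one.2 fun D hD D' hD' => ?_
    obtain ⟨hD, h0⟩ := Finset.mem_filter.1 hD
    obtain ⟨hD', h0'⟩ := Finset.mem_filter.1 hD'
    rw [Finset.card_eq_zero] at h0 h0'
    have hDS := (mem_feasibleBases.1 hD).1
    exact (hopt.2 S subset_rfl ⟨D, hD, hDS⟩).unique ⟨hD, hDS, by simp [h0]⟩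
      ⟨hD', (mem_feasibleBases.1 hD').1, by simp [h0']⟩
  · exact succ_mul_card_filter_le
      (fun D hD => ⟨(mem_feasibleBases.1 hD).1, (mem_feasibleBases.1 hD).2.1⟩) hopt.1
      fun p _ => h.card_filter_erase_le hσ hz p j

end FeasibleBasis

/-! ### Positive weights for relative interior points -/

theorem exists_weights_of_mem_intrinsicInterior {E : Type*} [NormedAddCommGroup E]
    [NormedSpace ℝ E] {D : Finset E} {y : E}
    (hy : y ∈ intrinsicInterior ℝ (convexHull ℝ (D : Set E))) {x₀ : E} (hx₀ : x₀ ∈ D) :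
    ∃ c : E → ℝ, (∀ x ∈ D, 0 ≤ c x) ∧ 0 < c x₀ ∧ ∑ x ∈ D, c x = 1 ∧ ∑ x ∈ D, c x • x = y := by
  classical
  obtain ⟨y', hy', rfl⟩ := mem_intrinsicInterior.1 hy
  have hx₀' : x₀ ∈ affineSpan ℝ (convexHull ℝ (D : Set E)) :=
    subset_affineSpan _ _ (subset_convexHull _ _ hx₀)
  -- Overshoot `y` slightly on the ray from `x₀`; then `y` averages the overshot point and `x₀`,
  -- which gives `x₀` positive weight.
  let f : ℝ → affineSpan ℝ (convexHull ℝ (D : Set E)) := fun ε =>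
    ⟨AffineMap.lineMap x₀ (y' : E) (1 + ε), AffineMap.lineMap_mem _ hx₀' y'.2⟩
  have hf : Continuous f := by
    refine Continuous.subtype_mk ?_ _
    exact AffineMap.lineMap_continuous.comp (continuous_const.add continuous_id)
  have hf0 : f 0 = y' := Subtype.ext (by simp [f])
  have hev : ∀ᶠ ε in nhds (0 : ℝ), (f ε : E) ∈ convexHull ℝ (D : Set E) := by
    have h := mem_interior_iff_mem_nhds.1 hy'
    rw [← hf0] at h
    exact hf.continuousAt.preimage_mem_nhds h
  obtain ⟨ε, hε, hε0⟩ := ((hev.filter_mono nhdsWithin_le_nhds).and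
    (self_mem_nhdsWithin : Set.Ioi (0 : ℝ) ∈ nhdsWithin 0 (Set.Ioi 0))).exists
  replace hε0 : 0 < ε := hε0
  obtain ⟨w, hw, hw1, hwy⟩ := Finset.mem_convexHull'.1 hε
  have hpos : 0 < 1 + ε := by linarith
  refine ⟨fun x => (1 + ε)⁻¹ * (w x + if x = x₀ then ε else 0), fun x hx => ?_, ?_, ?_, ?_⟩
  · have := hw x hx
    positivity
  · have := hw x₀ hx₀
    simp only [if_pos]
    positivity
  · rw [← Finset.mul_sum, Finset.sum_add_distrib, hw1, Finset.sum_ite_eq' D x₀, if_pos hx₀]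
    exact inv_mul_cancel₀ hpos.ne'
  · simp only [mul_smul, add_smul, ite_smul, zero_smul]
    rw [← Finset.smul_sum, Finset.sum_add_distrib, hwy, Finset.sum_ite_eq' D x₀, if_pos hx₀,
      inv_smul_eq_iff₀ hpos.ne']
    simp only [f, AffineMap.lineMap_apply_module]
    module

theorem exists_pos_weights_of_mem_intrinsicInterior {E : Type*} [NormedAddCommGroup E]
    [NormedSpace ℝ E] {D : Finset E} {y : E}
    (hy : y ∈ intrinsicInterior ℝ (convexHull ℝ (D : Set E))) :
    ∃ c : E → ℝ, (∀ x ∈ D, 0 < c x) ∧ ∑ x ∈ D, c x = 1 ∧ ∑ x ∈ D, c x • x = y := by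
  have hne : D.Nonempty := by
    rw [← Finset.coe_nonempty, ← convexHull_nonempty_iff (𝕜 := ℝ)]
    exact ⟨y, intrinsicInterior_subset hy⟩
  choose! c hc0 hcpos hc1 hcy using
    fun (x₀ : E) (h : x₀ ∈ D) => exists_weights_of_mem_intrinsicInterior hy h
  have hD : (0 : ℝ) < D.card := by exact_mod_cast hne.card_pos
  refine ⟨fun x => (D.card : ℝ)⁻¹ * ∑ x₀ ∈ D, c x₀ x, fun x hx => ?_, ?_, ?_⟩
  · exact mul_pos (inv_pos.2 hD)
      (Finset.sum_pos' (fun x₀ hx₀ => hc0 x₀ hx₀ x hx) ⟨x, hx, hcpos x hx⟩)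
  · rw [← Finset.mul_sum, Finset.sum_comm, Finset.sum_congr rfl hc1, Finset.sum_const,
      nsmul_eq_mul, mul_one, inv_mul_cancel₀ hD.ne']
  · simp only [mul_smul, Finset.sum_smul]
    rw [← Finset.smul_sum, Finset.sum_comm, Finset.sum_congr rfl hcy, Finset.sum_const,
      ← Nat.cast_smul_eq_nsmul ℝ, inv_smul_smul₀ hD.ne']

/-! ### Projection along the line and genericity -/

section Projection

open Module

variable {E : Type*} [NormedAddCommGroup E] [InnerProductSpace ℝ E]

/-- The homogenization `E × ℝ` of `E`, projected along the direction `v`. -/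
abbrev DirQuotient (v : E) : Type _ := (E × ℝ) ⧸ Submodule.span ℝ {((v, 0) : E × ℝ)}

/-- The homogenized point `(x, 1)`, projected along the direction `v`. -/
def homPt (v x : E) : DirQuotient v := Submodule.mkQ _ (x, 1)

/-- The homogeneous coordinate, as a functional on the projection. -/
def homCoord (v : E) : DirQuotient v →ₗ[ℝ] ℝ :=
  Submodule.liftQ _ (LinearMap.snd ℝ E ℝ) (by
    rw [Submodule.span_singleton_le_iff_mem]
    simp)

theorem homCoord_homPt (v x : E) : homCoord v (homPt v x) = 1 := rfl

/-- The graph over the projection of the hyperplane `⟪u, x⟫ = c`, where height is measured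
by `⟪v, x⟫`. -/
noncomputable def hyperplaneHeight (u v : E) (c : ℝ) (huv : inner ℝ u v ≠ 0) :
    DirQuotient v →ₗ[ℝ] ℝ :=
  Submodule.liftQ _ ((innerₛₗ ℝ v).comp (LinearMap.fst ℝ E ℝ)
    - (inner ℝ v v / inner ℝ u v) • ((innerₛₗ ℝ u).comp (LinearMap.fst ℝ E ℝ)
      - c • LinearMap.snd ℝ E ℝ)) (by
    rw [Submodule.span_singleton_le_iff_mem, LinearMap.mem_ker]
    simp [huv])

theorem hyperplaneHeight_homPt (u v : E) (c : ℝ) (huv : inner ℝ u v ≠ 0) (x : E) :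
    hyperplaneHeight u v c huv (homPt v x)
      = inner ℝ v x - inner ℝ v v / inner ℝ u v * (inner ℝ u x - c) := by
  simp [hyperplaneHeight, homPt]

theorem homPt_add_smul (v p : E) (t : ℝ) : homPt v (p + t • v) = homPt v p := by
  rw [homPt, homPt, Submodule.mkQ_apply, Submodule.mkQ_apply, Submodule.Quotient.eq,
    Submodule.mem_span_singleton]
  exact ⟨t, by simp⟩

theorem sum_smul_homPt (v : E) {D : Finset E} {c : E → ℝ} (hc : ∑ x ∈ D, c x = 1) :
    ∑ x ∈ D, c x • homPt v x = homPt v (∑ x ∈ D, c x • x) := by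
  simp only [homPt, ← map_smul, ← map_sum]
  congr 1
  ext <;> simp [Prod.fst_sum, Prod.snd_sum, hc]

theorem linearIndepOn_homPt {v u : E} {c : ℝ} (huv : inner ℝ u v ≠ 0) {D : Finset E}
    (hD : ∀ x ∈ D, inner ℝ u x = c) (hind : AffineIndependent ℝ (fun x : D => (x : E))) :
    LinearIndepOn ℝ (homPt v) (D : Set E) := by
  rw [linearIndepOn_finset_iff]
  intro w hw
  have h1 : Submodule.mkQ (Submodule.span ℝ {((v, 0) : E × ℝ)})
      (∑ x ∈ D, w x • x, ∑ x ∈ D, w x) = 0 := by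
    rw [← hw]
    simp only [homPt, ← map_smul, ← map_sum]
    congr 1
    ext <;> simp [Prod.fst_sum, Prod.snd_sum]
  rw [Submodule.mkQ_apply, Submodule.Quotient.mk_eq_zero, Submodule.mem_span_singleton] at h1
  obtain ⟨s, hs⟩ := h1
  have hs1 : s • v = ∑ x ∈ D, w x • x := congrArg Prod.fst hs
  have hs2 : 0 = ∑ x ∈ D, w x := by simpa using congrArg Prod.snd hs
  have hs0 : s = 0 := by
    have h2 := congrArg (inner ℝ u) hs1
    have h3 : ∑ x ∈ D, w x * inner ℝ u x = 0 := by
      rw [Finset.sum_congr rfl fun x hx => by rw [hD x hx], ← Finset.sum_mul, ← hs2, zero_mul]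
    simp only [inner_sum, inner_smul_right, h3] at h2
    exact (mul_eq_zero.1 h2).resolve_right huv
  rw [hs0, zero_smul] at hs1
  intro x hx
  have := (affineIndependent_iff.1 hind) Finset.univ (fun x => w x)
    (by rw [Finset.sum_coe_sort D w, ← hs2])
    (by rw [Finset.sum_coe_sort D (fun x => w x • x), ← hs1])
  exact this ⟨x, hx⟩ (Finset.mem_univ _)

variable [FiniteDimensional ℝ E]

theorem finrank_dirQuotient {v : E} (hv : v ≠ 0) :
    finrank ℝ (DirQuotient v) = finrank ℝ E := by
  have h := Submodule.finrank_quotient_add_finrank (Submodule.span ℝ {((v, 0) : E × ℝ)})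
  rw [finrank_span_singleton (by simpa using hv), finrank_prod, finrank_self] at h
  exact Nat.add_right_cancel h

open MeasureTheory in
theorem ae_homPt_notMem [MeasurableSpace E] [BorelSpace E] (v : E)
    {U : Submodule ℝ (DirQuotient v)} (hU : U ≠ ⊤) :
    ∀ᵐ p : E, homPt v p ∉ U := by
  let f : E →ᵃ[ℝ] DirQuotient v := (Submodule.mkQ _).toAffineMap.comp
    ((AffineMap.id ℝ E).prod (AffineMap.const ℝ E (1 : ℝ)))
  have hnull := Measure.addHaar_affineSubspace (volume : Measure E)
    (U.toAffineSubspace.comap f) (fun htop => hU ?_)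
  · exact measure_eq_zero_iff_ae_notMem.1 hnull
  · have hmem : ∀ x, homPt v x ∈ U := fun x => by
      have : x ∈ U.toAffineSubspace.comap f := htop ▸ AffineSubspace.mem_top ℝ E x
      exact this
    rw [eq_top_iff]
    rintro w -
    obtain ⟨⟨x, s⟩, rfl⟩ := Submodule.mkQ_surjective _ w
    have : ((x, s) : E × ℝ) = ((x, 1) - (0, 1)) + s • (0, 1) := by ext <;> simp
    rw [this, map_add, map_sub, map_smul]
    exact U.add_mem (U.sub_mem (hmem x) (hmem 0)) (U.smul_mem s (hmem 0))

open MeasureTheory in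
theorem ae_genPos_homPt [MeasurableSpace E] [BorelSpace E] (v : E) (A : Finset E) :
    ∀ᵐ p : E, GenPos A (homPt v) (homPt v p) := by
  classical
  have h : ∀ᵐ p : E, ∀ T ∈ A.powerset, T.card < finrank ℝ (DirQuotient v) →
      homPt v p ∉ Submodule.span ℝ (homPt v '' T) := by
    rw [Filter.eventually_all_finset]
    intro T _
    by_cases hT : T.card < finrank ℝ (DirQuotient v)
    · refine (ae_homPt_notMem v fun htop => ?_).mono fun p hp _ => hp
      have := finrank_span_finset_le_card (R := ℝ) (T.image (homPt v))
      rw [Finset.coe_image, Set.finrank, htop, finrank_top] at this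
      exact (this.trans Finset.card_image_le).not_gt hT
    · exact Filter.Eventually.of_forall fun p h => absurd h hT
  exact h.mono fun p hp T hT => hp T (Finset.mem_powerset.2 hT)

theorem eventually_posRep_homPt {v p : E} {D : Finset E}
    (hind : LinearIndepOn ℝ (homPt v) (D : Set E)) (hcard : D.card = finrank ℝ (DirQuotient v))
    (hp : PosRep (homPt v) (homPt v p) D) :
    ∀ᶠ p' in nhds p, PosRep (homPt v) (homPt v p') D := by
  classical
  obtain ⟨e, he⟩ := exists_basis_of_linearIndepOn hind hcard
  obtain ⟨c, hc, hcp⟩ := hp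
  have hrepr : ∀ i : D, e.repr (homPt v p) i = c i := by
    intro i
    have : homPt v p = ∑ i : D, c i • e i := by
      rw [← hcp, ← Finset.sum_coe_sort]
      exact Finset.sum_congr rfl fun i _ => by rw [he]
    rw [this, e.repr_sum_self]
  have hcont : ∀ i : D, Continuous fun p' => e.repr (homPt v p') i := by
    intro i
    have h1 : Continuous ((e.coord i).comp
        (Submodule.mkQ (Submodule.span ℝ {((v, 0) : E × ℝ)}))) :=
      LinearMap.continuous_of_finiteDimensional _
    exact h1.comp (continuous_id.prodMk continuous_const)
  have hev : ∀ᶠ p' in nhds p, ∀ i : D, 0 < e.repr (homPt v p') i := by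
    rw [Filter.eventually_all]
    refine fun i => (hcont i).continuousAt.eventually_const_lt ?_
    exact (hc i i.2).trans_eq (hrepr i).symm
  refine hev.mono fun p' hp' =>
    ⟨fun x => if hx : x ∈ D then e.repr (homPt v p') ⟨x, hx⟩ else 0, fun x hx => ?_, ?_⟩
  · simpa only [dif_pos hx] using hp' ⟨x, hx⟩
  · rw [← Finset.sum_coe_sort]
    conv_rhs => rw [← e.sum_repr (homPt v p')]
    exact Finset.sum_congr rfl fun i _ => by simp [he]

theorem nondegHeights_inner [DecidableEq E] {A : Finset E} {v : E} (hv : v ≠ 0)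
    (hA : ∀ S ⊆ A, S.card = finrank ℝ E + 1 →
      ¬ ∃ (u : E) (c : ℝ), u ≠ 0 ∧ ∀ x ∈ S, inner ℝ u x = c) {b : DirQuotient v}
    (hb : GenPos A (homPt v) b) : NondegHeights A (homPt v) b (fun x => inner ℝ v x) := by
  intro D hD q hq heq
  obtain ⟨hqA, hqD⟩ := Finset.mem_sdiff.1 hq
  obtain ⟨hDA, hcard, -⟩ := mem_feasibleBases.1 hD
  set ψ := interp (homPt v) (fun x => inner ℝ v x) D with hψ
  let φ : E →ₗ[ℝ] ℝ := innerₛₗ ℝ v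
    - (ψ.comp (Submodule.mkQ (Submodule.span ℝ {((v, 0) : E × ℝ)}))).comp (LinearMap.inl ℝ E ℝ)
  have hφ : ∀ x, φ x = inner ℝ v x - ψ (Submodule.mkQ _ (x, 0)) := fun x => rfl
  have hu : ∀ x, inner ℝ ((InnerProductSpace.toDual ℝ E).symm φ.toContinuousLinearMap) x
      = φ x := fun x => by simp
  have hφ' : ∀ x, inner ℝ v x = ψ (homPt v x) → φ x = ψ (homPt v 0) := by
    intro x hx
    rw [hφ, hx, homPt, homPt, ← map_sub, ← map_sub]
    simp
  refine hA (insert q D) (Finset.insert_subset hqA hDA) ?_ ⟨_, ψ (homPt v 0), fun h0 => ?_,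
    fun x hx => (hu x).trans (hφ' x ?_)⟩
  · rw [Finset.card_insert_of_notMem hqD, hcard, finrank_dirQuotient hv]
  -- The normal is nonzero since `φ v = ⟪v, v⟫`.
  · have h1 := hu v
    have h2 : Submodule.mkQ (Submodule.span ℝ {((v, 0) : E × ℝ)}) (v, 0) = 0 := by
      rw [Submodule.mkQ_apply, Submodule.Quotient.mk_eq_zero]
      exact Submodule.mem_span_singleton_self _
    rw [h0, inner_zero_left, hφ, h2, map_zero, sub_zero] at h1
    exact hv (inner_self_eq_zero.1 h1.symm)
  · rcases Finset.mem_insert.1 hx with rfl | hx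
    · exact heq
    · exact (hb.interp_apply hD _ hx).symm

end Projection

/-! ### Entered facets as feasible bases -/

theorem Enters.posRep {d : ℕ} {A D : Finset (EuclideanSpace ℝ (Fin d))} {k : ℕ}
    {p v : EuclideanSpace ℝ (Fin d)} (h : Enters A k p v D) :
    PosRep (homPt v) (homPt v p) D := by
  obtain ⟨⟨t, ht⟩, -⟩ := h
  obtain ⟨c, hc, hc1, hcy⟩ := exists_pos_weights_of_mem_intrinsicInterior ht
  exact ⟨c, hc, by rw [sum_smul_homPt v hc1, hcy, homPt_add_smul]⟩

theorem proposition4p2 {d : ℕ} (A : Finset (EuclideanSpace ℝ (Fin d))) (hA : GenericSet A)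
    (k : ℕ) (p v : EuclideanSpace ℝ (Fin d)) (hv : v ≠ 0) :
    {D : Finset (EuclideanSpace ℝ (Fin d)) | IsKFacet A k D ∧ Enters A k p v D}.encard
      ≤ ((d + k - 1).choose (d - 1) : ℕ) := by
  classical
  have hrank : Module.finrank ℝ (DirQuotient v) = d := by
    rw [finrank_dirQuotient hv, finrank_euclideanSpace_fin]
  have hd : 1 ≤ d := by
    rcases Nat.eq_zero_or_pos d with rfl | h
    · exact absurd (Subsingleton.elim v 0) hv
    · exact h
  have hev : ∀ᶠ p' in nhds p, ∀ D ∈ A.powerset, IsKFacet A k D → Enters A k p v D →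
      PosRep (homPt v) (homPt v p') D := by
    rw [Filter.eventually_all_finset]
    intro D _
    by_cases h : IsKFacet A k D ∧ Enters A k p v D
    · obtain ⟨⟨-, hcard, hind, -⟩, hent⟩ := h
      obtain ⟨-, u, c, hsplit, huv⟩ := id hent
      exact (eventually_posRep_homPt (linearIndepOn_homPt huv.ne' hsplit.2.1 hind)
        (hcard.trans hrank.symm) hent.posRep).mono fun _ h _ _ => h
    · exact Filter.Eventually.of_forall fun _ h1 h2 => absurd ⟨h1, h2⟩ h
  obtain ⟨p', hgen, hpos⟩ :=
    (MeasureTheory.Measure.dense_of_ae (ae_genPos_homPt v A)).inter_nhds_nonempty hev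
  have hnd := nondegHeights_inner hv (by simpa using hA.1) hgen
  have hbound := hgen.card_filter_below_le (fun x _ => homCoord_homPt v x) hnd
    (hrank.symm ▸ hd) k
  rw [hrank] at hbound
  refine le_trans (Set.encard_le_encard ?_) ((Set.encard_coe_eq_coe_finsetCard _).trans_le
    (Nat.cast_le.2 hbound))
  rintro D ⟨hfacet, hent⟩
  obtain ⟨hDA, hcard, -, -⟩ := id hfacet
  obtain ⟨-, u, c, hsplit, huv⟩ := id hent
  have hD : D ∈ feasibleBases A (homPt v) (homPt v p') := mem_feasibleBases.2
    ⟨hDA, hcard.trans hrank.symm, hpos D (Finset.mem_powerset.2 hDA) hfacet hent⟩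
  refine Finset.mem_coe.2 (Finset.mem_filter.2 ⟨hD, ?_⟩)
  have hint : interp (homPt v) (fun x => inner ℝ v x) D = hyperplaneHeight u v c huv.ne' := by
    refine hgen.eq_interp hD fun x hx => ?_
    rw [hyperplaneHeight_homPt, hsplit.2.1 x hx, sub_self, mul_zero, sub_zero]
  rw [← hsplit.2.2.1, below]
  congr 1
  refine Finset.filter_congr fun x _ => ?_
  -- The direction of entry matters here: it makes "below" the side with `k` points.
  have hκ : 0 < inner ℝ v v / inner ℝ u v := div_pos (real_inner_self_pos.2 hv) huv
  rw [hint, hyperplaneHeight_homPt, lt_sub_iff_add_lt, add_lt_iff_neg_left,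
    ← neg_pos, ← mul_neg, mul_pos_iff_of_pos_left hκ, neg_sub, sub_pos]
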